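/- **Definitions.** Let $G$ be a group and write $[A,B]$ for the subgroup generated by the commutators of elements of $A$ and $B$, and $[A_1,\dots,A_{m+1}]=[[A_1,\dots,A_m],A_{m+1}]$ with $[A_1]=A_1$. For a commutative monoid $M$ and a function $\phi$ from $M$ to the subgroups of $G$, put $\phi_s^+=\langle \phi_{s+t} : t\in M\setminus\{0\}\rangle$. The *length* of $\phi$ is the number of $s\in M\setminus\{0\}$ with $\phi_s\neq\phi_s^+$. The function $\phi$ is a *filter* if $\phi_0=G$ and $[\phi_s,\phi_t]\le\phi_{s+t}\le\phi_s\cap\phi_t$ for all $s,t\in M$; then $L_s=\phi_s/\phi_s^+$ is abelian for $s\ne 0$, and commutation induces biadditive maps $[\,,]:L_s\times L_t\to L_{s+t}$ for $s,t\neq 0$. For a prime $p$, the *$\eta$ series* (exponent-$p$ central series) of $G$ is the filter on $\mathbb N=\{0,1,2,\dots\}$ given by $\eta_0=\eta_1=G$ and $\eta_{i+1}=[G,\eta_i]\,\eta_i^p$ for $i\ge 1$, where $\eta_i^p$ is generated by the $p$-th powers of the elements of $\eta_i$. Let $\phi$ be a filter on $\mathbb N$ and let $s$ be the least nonzero index with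 $L_s\ne 0$. The adjoint ring of $[\,,]:L_s\times L_s\to L_{2s}$ is $$A=\{(X,Y)\in \mathrm{End}(L_s)\times\mathrm{End}(L_s)^{\mathrm{op}} : [uX,v]=[u,Yv]\text{ for all }u,v\in L_s\},$$ where $X$ acts on the right and $Y$ on the left. Let $J$ be its Jacobson radical, $J^0=A$, $J^{i+1}=J^iJ$, and let $H_i$ be the subgroup with $\phi_s^+\le H_i\le\phi_s$ and $H_i/\phi_s^+=L_sJ^i$. Let $\mathtt X$ be the set of pairs $(u,i)\in\mathbb N^2$ with $u\le s$ (equivalently, those preceding $(s+1,0)$ lexicographically), and for $(u,i)\in\mathtt X$ put $\alpha_{(u,i)}=H_i$ if $u=s$ and $\alpha_{(u,i)}=\phi_u$ otherwise. The *lex-least adjoint refinement* of $\phi$ is the function $\bar\alpha$ on $\mathbb N^2$ whose value $\bar\alpha_x$ is the subgroup generated by all $[\alpha_{x_1},\dots,\alpha_{x_d}]$ with $d\ge1$, $x_1,\dots,x_d\in\mathtt X$ and $x_1+\dots+x_d=x$. **Theorem.** There is a constant $c>0$ such that for every prime $p$ and all sufficiently large $n$ (depending on $p$) there are at least $$p^{\,2n^3/729+c\,n^2}$$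 pairwise nonisomorphic groups of order $p^n$ whose $\eta$ series has length $2$ and whose lex-least adjoint refinement of the $\eta$ series has length at least $6$. -/

import Mathlib

/-! ### Filters on groups -/

/-- A filter on a group `G` over a commutative monoid `M`: subgroups `φ s` with `φ 0 = G` and
`[φ s, φ t] ≤ φ (s + t) ≤ φ s ∩ φ t`. -/
structure GroupFilter (G M : Type*) [Group G] [AddCommMonoid M] where
  toFun : M → Subgroup G
  map_zero : toFun 0 = ⊤
  commutator_le : ∀ s t, ⁅toFun s, toFun t⁆ ≤ toFun (s + t)
  map_add_le : ∀ s t, toFun (s + t) ≤ toFun s ⊓ toFun t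

/-- `φ_s⁺ = ∏_{t ≠ 0} φ_{s + t}`. -/
def seriesBoundary {G M : Type*} [Group G] [AddCommMonoid M] (φ : M → Subgroup G) (s : M) :
    Subgroup G :=
  ⨆ (t : M) (_ : t ≠ 0), φ (s + t)

/-- The length of a series `φ : M → 2^G`: the number of `s ≠ 0` for which the factor
`L_s = φ_s / φ_s⁺` is nontrivial. -/
noncomputable def seriesLength {G M : Type*} [Group G] [AddCommMonoid M] (φ : M → Subgroup G) :
    ℕ∞ :=
  Set.encard {s : M | s ≠ 0 ∧ seriesBoundary φ s ≠ φ s}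

namespace GroupFilter

open scoped commutatorElement

variable {G M : Type*} [Group G] [AddCommMonoid M]

instance : CoeFun (GroupFilter G M) (fun _ => M → Subgroup G) := ⟨GroupFilter.toFun⟩

/-- The subgroup `φ_s⁺`. -/
def boundary (φ : GroupFilter G M) (s : M) : Subgroup G := seriesBoundary φ s

theorem normal (φ : GroupFilter G M) (s : M) : (φ s).Normal := by
  rw [← Subgroup.commutator_top_left_le_iff, ← φ.map_zero]
  simpa using φ.commutator_le 0 s

instance boundary_normal (φ : GroupFilter G M) (s : M) : (φ.boundary s).Normal := by
  unfold boundary seriesBoundary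
  have := φ.normal
  infer_instance

theorem le_boundary (φ : GroupFilter G M) (s : M) {t : M} (ht : t ≠ 0) :
    φ (s + t) ≤ φ.boundary s :=
  le_iSup₂_of_le (f := fun (t : M) (_ : t ≠ 0) => φ (s + t)) t ht le_rfl

/-- `[φ_s⁺, φ_t] ≤ φ_{s+t}⁺`. -/
theorem commutator_boundary_left (φ : GroupFilter G M) (s t : M) :
    ⁅φ.boundary s, φ t⁆ ≤ φ.boundary (s + t) := by
  rw [Subgroup.commutator_comm, Subgroup.commutator_le]
  intro y hy x hx
  have key : φ.boundary s ≤ (Subgroup.centralizer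
      (((φ t).map (QuotientGroup.mk' (φ.boundary (s + t)))) : Set _)).comap
      (QuotientGroup.mk' (φ.boundary (s + t))) := by
    refine iSup₂_le fun r hr z hz => ?_
    rw [Subgroup.mem_comap, Subgroup.mem_centralizer_iff_commutator_eq_one]
    rintro _ ⟨w, hw, rfl⟩
    rw [← map_commutatorElement]
    refine (QuotientGroup.eq_one_iff _).2 (φ.le_boundary (s + t) hr ?_)
    have := φ.commutator_le t (s + r) (Subgroup.commutator_mem_commutator hw hz)
    rwa [show s + t + r = t + (s + r) by abel]
  have h1 := key hx
  rw [Subgroup.mem_comap, Subgroup.mem_centralizer_iff_commutator_eq_one] at h1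
  have h2 := h1 _ ⟨y, hy, rfl⟩
  rw [← map_commutatorElement] at h2
  exact (QuotientGroup.eq_one_iff _).1 h2

/-- The homogeneous component `L_s = φ_s / φ_s⁺`, written additively (used for `s ≠ 0`). -/
def Component (φ : GroupFilter G M) (s : M) : Type _ :=
  Additive (φ s ⧸ (φ.boundary s).subgroupOf (φ s))

instance (φ : GroupFilter G M) (s : M) : AddGroup (φ.Component s) :=
  inferInstanceAs (AddGroup (Additive (φ s ⧸ (φ.boundary s).subgroupOf (φ s))))

/-- The class in `L_s` of an element of `φ_s`. -/
def toComponent (φ : GroupFilter G M) (s : M) (x : φ s) : φ.Component s :=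
  Additive.ofMul (QuotientGroup.mk x)

theorem toComponent_surjective (φ : GroupFilter G M) (s : M) :
    Function.Surjective (φ.toComponent s) :=
  fun u => (QuotientGroup.mk_surjective (s := (φ.boundary s).subgroupOf (φ s)) u.toMul)

theorem toComponent_mul (φ : GroupFilter G M) (s : M) (x y : φ s) :
    φ.toComponent s (x * y) = φ.toComponent s x + φ.toComponent s y := rfl

theorem toComponent_eq_iff (φ : GroupFilter G M) (s : M) (x y : φ s) :
    φ.toComponent s x = φ.toComponent s y ↔ (x : G)⁻¹ * y ∈ φ.boundary s := by
  refine Iff.trans (Iff.trans Additive.ofMul.injective.eq_iff QuotientGroup.eq) ?_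
  rfl

instance (φ : GroupFilter G M) (s : M) [NeZero s] : AddCommGroup (φ.Component s) :=
  { (inferInstance : AddGroup (φ.Component s)) with
    add_comm := by
      intro u v
      obtain ⟨x, rfl⟩ := φ.toComponent_surjective s u
      obtain ⟨y, rfl⟩ := φ.toComponent_surjective s v
      rw [← toComponent_mul, ← toComponent_mul, toComponent_eq_iff]
      have h := φ.le_boundary s (NeZero.ne s) (φ.commutator_le s s
        (Subgroup.commutator_mem_commutator ((φ s).inv_mem y.2) ((φ s).inv_mem x.2)))
      simpa [commutatorElement_def, mul_assoc] using h }

/-- Modulo `φ_{s+t}⁺`, elements of `φ_s⁺` commute with elements of `φ_t`. -/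
theorem commute_boundary (φ : GroupFilter G M) (s t : M) {x y : G} (hx : x ∈ φ.boundary s)
    (hy : y ∈ φ t) : Commute (x : G ⧸ φ.boundary (s + t)) (y : G ⧸ φ.boundary (s + t)) := by
  rw [← commutatorElement_eq_one_iff_commute]
  exact (QuotientGroup.eq_one_iff _).2 (φ.commutator_boundary_left s t
    (Subgroup.commutator_mem_commutator hx hy))

/-- The commutation bimap `L_s × L_t → L_{s+t}`, sending the classes of `x` and `y` to the class of
`[x, y]`. (By biadditivity the conventions `x⁻¹ y⁻¹ x y` and `x y x⁻¹ y⁻¹` for `[x, y]` give the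
same map.) -/
def bracket (φ : GroupFilter G M) (s t : M) (u : φ.Component s) (v : φ.Component t) :
    φ.Component (s + t) :=
  Quotient.liftOn₂ u.toMul v.toMul
    (fun x y => φ.toComponent (s + t) ⟨⁅(x : G), (y : G)⁆,
      φ.commutator_le s t (Subgroup.commutator_mem_commutator x.2 y.2)⟩)
    (by
      intro x y x' y' hx hy
      have hx := QuotientGroup.leftRel_apply.1 hx
      have hy := QuotientGroup.leftRel_apply.1 hy
      rw [Subgroup.mem_subgroupOf] at hx hy
      rw [toComponent_eq_iff, ← QuotientGroup.eq]
      have hA := φ.commute_boundary s t hx y'.2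
      have hB := φ.commute_boundary t s hy x.2
      rw [add_comm t s] at hB
      simp only [commutatorElement_def, QuotientGroup.mk_mul, QuotientGroup.mk_inv,
        Subgroup.coe_mul, Subgroup.coe_inv] at hA hB ⊢
      generalize ((x : G) : G ⧸ φ.boundary (s + t)) = X at *
      generalize ((y : G) : G ⧸ φ.boundary (s + t)) = Y at *
      generalize ((x' : G) : G ⧸ φ.boundary (s + t)) = X' at *
      generalize ((y' : G) : G ⧸ φ.boundary (s + t)) = Y' at *
      obtain ⟨A, rfl⟩ : ∃ A, X' = X * A := ⟨X⁻¹ * X', by group⟩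
      obtain ⟨B, rfl⟩ : ∃ B, Y' = Y * B := ⟨Y⁻¹ * Y', by group⟩
      simp only [inv_mul_cancel_left] at hA hB
      calc X * Y * X⁻¹ * Y⁻¹ = X * Y * (X⁻¹ * B) * B⁻¹ * Y⁻¹ := by group
        _ = X * Y * (B * X⁻¹) * B⁻¹ * Y⁻¹ := by rw [(hB.inv_right).eq]
        _ = X * (Y * B * A) * A⁻¹ * X⁻¹ * (B⁻¹ * Y⁻¹) := by group
        _ = X * (A * (Y * B)) * A⁻¹ * X⁻¹ * (B⁻¹ * Y⁻¹) := by rw [hA.eq]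
        _ = X * A * (Y * B) * (X * A)⁻¹ * (Y * B)⁻¹ := by group)

theorem bracket_toComponent (φ : GroupFilter G M) (s t : M) (x : φ s) (y : φ t) :
    φ.bracket s t (φ.toComponent s x) (φ.toComponent t y) =
      φ.toComponent (s + t) ⟨⁅(x : G), (y : G)⁆,
        φ.commutator_le s t (Subgroup.commutator_mem_commutator x.2 y.2)⟩ := rfl

theorem bracket_add_left (φ : GroupFilter G M) (s t : M) [NeZero s] (u u' : φ.Component s)
    (v : φ.Component t) :
    φ.bracket s t (u + u') v = φ.bracket s t u v + φ.bracket s t u' v := by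
  obtain ⟨x, rfl⟩ := φ.toComponent_surjective s u
  obtain ⟨x', rfl⟩ := φ.toComponent_surjective s u'
  obtain ⟨y, rfl⟩ := φ.toComponent_surjective t v
  rw [add_comm (φ.toComponent s x), ← toComponent_mul]
  simp only [bracket_toComponent]
  rw [← toComponent_mul, toComponent_eq_iff, ← QuotientGroup.eq]
  have h2 := φ.commutator_le s t (Subgroup.commutator_mem_commutator x.2 y.2)
  have h1 : (x' : G) ∈ φ s := x'.2
  have h : Commute ((x' : G) : G ⧸ φ.boundary (s + t))
      ((⁅(x : G), (y : G)⁆ : G) : G ⧸ φ.boundary (s + t)) := by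
    rw [← commutatorElement_eq_one_iff_commute]
    refine (QuotientGroup.eq_one_iff _).2 (φ.le_boundary (s + t) (NeZero.ne s) ?_)
    rw [add_comm (s + t) s]
    exact φ.commutator_le s (s + t) (Subgroup.commutator_mem_commutator h1 h2)
  simp only [commutatorElement_def, QuotientGroup.mk_mul, QuotientGroup.mk_inv,
    Subgroup.coe_mul] at h ⊢
  generalize ((x : G) : G ⧸ φ.boundary (s + t)) = X at *
  generalize ((y : G) : G ⧸ φ.boundary (s + t)) = Y at *
  generalize ((x' : G) : G ⧸ φ.boundary (s + t)) = X' at *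
  calc X' * X * Y * (X' * X)⁻¹ * Y⁻¹ = (X' * (X * Y * X⁻¹ * Y⁻¹)) * (Y * X'⁻¹ * Y⁻¹) := by group
    _ = ((X * Y * X⁻¹ * Y⁻¹) * X') * (Y * X'⁻¹ * Y⁻¹) := by rw [h.eq]
    _ = X * Y * X⁻¹ * Y⁻¹ * (X' * Y * X'⁻¹ * Y⁻¹) := by group

theorem bracket_add_right (φ : GroupFilter G M) (s t : M) [NeZero t] (u : φ.Component s)
    (v v' : φ.Component t) :
    φ.bracket s t u (v + v') = φ.bracket s t u v + φ.bracket s t u v' := by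
  obtain ⟨x, rfl⟩ := φ.toComponent_surjective s u
  obtain ⟨y, rfl⟩ := φ.toComponent_surjective t v
  obtain ⟨y', rfl⟩ := φ.toComponent_surjective t v'
  rw [← toComponent_mul]
  simp only [bracket_toComponent]
  rw [← toComponent_mul, toComponent_eq_iff, ← QuotientGroup.eq]
  have h2 := φ.commutator_le s t (Subgroup.commutator_mem_commutator x.2 y'.2)
  have h1 : (y : G) ∈ φ t := y.2
  have h : Commute ((y : G) : G ⧸ φ.boundary (s + t))
      ((⁅(x : G), (y' : G)⁆ : G) : G ⧸ φ.boundary (s + t)) := by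
    rw [← commutatorElement_eq_one_iff_commute]
    refine (QuotientGroup.eq_one_iff _).2 (φ.le_boundary (s + t) (NeZero.ne t) ?_)
    rw [add_comm (s + t) t]
    exact φ.commutator_le t (s + t) (Subgroup.commutator_mem_commutator h1 h2)
  simp only [commutatorElement_def, QuotientGroup.mk_mul, QuotientGroup.mk_inv,
    Subgroup.coe_mul] at h ⊢
  generalize ((x : G) : G ⧸ φ.boundary (s + t)) = X at *
  generalize ((y : G) : G ⧸ φ.boundary (s + t)) = Y at *
  generalize ((y' : G) : G ⧸ φ.boundary (s + t)) = Y' at *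
  calc X * (Y * Y') * X⁻¹ * (Y * Y')⁻¹ = X * Y * X⁻¹ * Y⁻¹ * (Y * (X * Y' * X⁻¹ * Y'⁻¹)) * Y⁻¹ := by
        group
    _ = X * Y * X⁻¹ * Y⁻¹ * ((X * Y' * X⁻¹ * Y'⁻¹) * Y) * Y⁻¹ := by rw [h.eq]
    _ = X * Y * X⁻¹ * Y⁻¹ * (X * Y' * X⁻¹ * Y'⁻¹) := by group

theorem bracket_zero_left (φ : GroupFilter G M) (s t : M) [NeZero s] (v : φ.Component t) :
    φ.bracket s t 0 v = 0 := by
  have h := φ.bracket_add_left s t 0 0 v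
  rw [add_zero] at h
  exact left_eq_add.1 h

theorem bracket_zero_right (φ : GroupFilter G M) (s t : M) [NeZero t] (u : φ.Component s) :
    φ.bracket s t u 0 = 0 := by
  have h := φ.bracket_add_right s t u 0 0
  rw [add_zero] at h
  exact left_eq_add.1 h

theorem bracket_neg_left (φ : GroupFilter G M) (s t : M) [NeZero s] (u : φ.Component s)
    (v : φ.Component t) : φ.bracket s t (-u) v = -φ.bracket s t u v := by
  rw [eq_neg_iff_add_eq_zero, ← bracket_add_left, neg_add_cancel, bracket_zero_left]

theorem bracket_neg_right (φ : GroupFilter G M) (s t : M) [NeZero t] (u : φ.Component s)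
    (v : φ.Component t) : φ.bracket s t u (-v) = -φ.bracket s t u v := by
  rw [eq_neg_iff_add_eq_zero, ← bracket_add_right, neg_add_cancel, bracket_zero_right]

/-! ### The adjoint ring -/

/-- The adjoint ring of `[,] : L_s × L_t → L_{s+t}`: all pairs `(X, Y)` of additive endomorphisms,
`X` acting on `L_s` from the right and `Y` acting on `L_t` from the left, such that
`[u X, v] = [u, Y v]`. Mathlib writes endomorphisms on the left, so a ring of endomorphisms acting
from the right is the opposite of `AddMonoid.End`. -/
def adjointRing (φ : GroupFilter G M) (s t : M) [NeZero s] [NeZero t] :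
    Subring ((AddMonoid.End (φ.Component s))ᵐᵒᵖ × AddMonoid.End (φ.Component t)) where
  carrier := {a | ∀ (u : φ.Component s) (v : φ.Component t),
    φ.bracket s t (a.1.unop u) v = φ.bracket s t u (a.2 v)}
  mul_mem' := by
    intro a b ha hb u v
    change φ.bracket s t (b.1.unop (a.1.unop u)) v = φ.bracket s t u (a.2 (b.2 v))
    rw [hb, ha]
  one_mem' := fun u v => rfl
  add_mem' := by
    intro a b ha hb u v
    change φ.bracket s t (a.1.unop u + b.1.unop u) v = φ.bracket s t u (a.2 v + b.2 v)
    rw [bracket_add_left, bracket_add_right, ha, hb]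
  zero_mem' := by
    intro u v
    change φ.bracket s t 0 v = φ.bracket s t u 0
    rw [bracket_zero_left, bracket_zero_right]
  neg_mem' := by
    intro a ha u v
    change φ.bracket s t (-(a.1.unop u)) v = φ.bracket s t u (-(a.2 v))
    rw [bracket_neg_left, bracket_neg_right, ha]

/-- The power `J^i` of the Jacobson radical `J` of a ring `R`: `J^0 = R` and `J^(i+1) = J^i J`. -/
def radicalPower (R : Type*) [Ring R] (i : ℕ) : Ideal R := Ring.jacobson R ^ i

/-- The subgroup `L_s J^i` of `L_s`, with `J` the Jacobson radical of the adjoint ring of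
`[,] : L_s × L_s → L_{s+s}`. -/
def componentRadical (φ : GroupFilter G M) (s : M) [NeZero s] (i : ℕ) :
    AddSubgroup (φ.Component s) :=
  AddSubgroup.closure {w | ∃ (u : φ.Component s) (a : φ.adjointRing s s),
    a ∈ radicalPower (φ.adjointRing s s) i ∧ w = a.1.1.unop u}

/-- The subgroup `H_i` with `φ_s⁺ ≤ H_i ≤ φ_s` and `H_i / φ_s⁺ = L_s J^i`. -/
def radicalSubgroup (φ : GroupFilter G M) (s : M) [NeZero s] (i : ℕ) : Subgroup G where
  carrier := {x | ∃ hx : x ∈ φ s, φ.toComponent s ⟨x, hx⟩ ∈ φ.componentRadical s i}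
  mul_mem' := by
    rintro x y ⟨hx, hx'⟩ ⟨hy, hy'⟩
    exact ⟨(φ s).mul_mem hx hy, (φ.componentRadical s i).add_mem hx' hy'⟩
  one_mem' := ⟨(φ s).one_mem, (φ.componentRadical s i).zero_mem⟩
  inv_mem' := by
    rintro x ⟨hx, hx'⟩
    exact ⟨(φ s).inv_mem hx, (φ.componentRadical s i).neg_mem hx'⟩

end GroupFilter

/-! ### Generated filters and lex-least adjoint refinements -/

/-- The iterated commutator `[A₁, …, A_d]`, with `[A₁] = A₁` and
`[A₁, …, A_{m+1}] = [[A₁, …, A_m], A_{m+1}]` (the empty list is never used). -/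
def iteratedCommutator {G : Type*} [Group G] : List (Subgroup G) → Subgroup G
  | [] => ⊥
  | A :: l => l.foldl (fun B C => ⁅B, C⁆) A

/-- The function `M → 2^G` generated by `π : X → 2^G`, where `X` generates `M`: its value at `s` is
the product of the `[π_{s₁}, …, π_{s_d}]` over all sequences `s₁, …, s_d` (`d ≥ 1`) in `X` with
`s = s₁ + ⋯ + s_d`. (Only the values of `π` on `X` matter.) -/
def generatedSeries {G M : Type*} [Group G] [AddCommMonoid M] (X : Set M) (π : M → Subgroup G)
    (s : M) : Subgroup G :=
  ⨆ (l : List M) (_ : l ≠ [] ∧ (∀ x ∈ l, x ∈ X) ∧ l.sum = s), iteratedCommutator (l.map π)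

/-- For a filter `φ` on `ℕ` and `s ≠ 0`, the series on `ℕ × ℕ` generated by
`α_u^i = φ_u` if `i = 0` or `u ≠ s`, and `α_s^i = H_i`, on the set of all `(u, i)` that precede
`(s + 1, 0)` in the lexicographic order in which the first coordinate is the more significant. -/
noncomputable def adjointRefinement {G : Type*} [Group G] (φ : GroupFilter G ℕ) (s : ℕ) [NeZero s] :
    ℕ × ℕ → Subgroup G :=
  generatedSeries {x : ℕ × ℕ | toLex x < toLex (s + 1, 0)}
    (fun x => if x.2 = 0 ∨ x.1 ≠ s then φ x.1 else φ.radicalSubgroup s x.2)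

/-- `α` is the lex-least adjoint refinement of the filter `φ` on `ℕ`: the one that refines the first
component `L_s ≠ 0` with `s ≠ 0`. -/
def IsLexLeastAdjointRefinement {G : Type*} [Group G] (φ : GroupFilter G ℕ)
    (α : ℕ × ℕ → Subgroup G) : Prop :=
  ∃ (s : ℕ) (_ : NeZero s), IsLeast {t : ℕ | t ≠ 0 ∧ φ.boundary t ≠ φ t} s ∧
    α = adjointRefinement φ s

/-! ### The exponent-`p` central series -/

/-- The exponent-`p` central series of `G`: `η_0 = η_1 = G` and `η_{i+1} = [G, η_i] η_i^p` for
`i > 0`, where `η_i^p` is the subgroup generated by the `p`-th powers of the elements of `η_i`. -/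
def etaSeries (p : ℕ) (G : Type*) [Group G] : ℕ → Subgroup G
  | 0 => ⊤
  | 1 => ⊤
  | i + 2 => ⁅(⊤ : Subgroup G), etaSeries p G (i + 1)⁆ ⊔
      Subgroup.closure {x | ∃ y ∈ etaSeries p G (i + 1), x = y ^ p}

namespace etaSeries

open scoped commutatorElement

variable (p : ℕ) (G : Type*) [Group G]

theorem succ_succ (i : ℕ) : etaSeries p G (i + 2) = ⁅(⊤ : Subgroup G), etaSeries p G (i + 1)⁆ ⊔
    Subgroup.closure {x | ∃ y ∈ etaSeries p G (i + 1), x = y ^ p} := by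
  rw [etaSeries]

theorem normal_aux (i : ℕ) : (etaSeries p G i).Normal ∧ (etaSeries p G (i + 1)).Normal := by
  induction i with
  | zero => rw [etaSeries, etaSeries]; exact ⟨inferInstance, inferInstance⟩
  | succ i ih =>
    refine ⟨ih.2, ?_⟩
    have := ih.2
    have : (Subgroup.closure {x | ∃ y ∈ etaSeries p G (i + 1), x = y ^ p}).Normal := by
      refine ⟨fun n hn g => ?_⟩
      suffices h : Subgroup.closure {x | ∃ y ∈ etaSeries p G (i + 1), x = y ^ p} ≤
          (Subgroup.closure {x | ∃ y ∈ etaSeries p G (i + 1), x = y ^ p}).comap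
            (MulAut.conj g).toMonoidHom from h hn
      rw [Subgroup.closure_le]
      rintro _ ⟨y, hy, rfl⟩
      refine Subgroup.subset_closure ⟨g * y * g⁻¹, ‹(etaSeries p G (i + 1)).Normal›.conj_mem y hy g,
        ?_⟩
      simp
    rw [succ_succ]
    infer_instance

instance normal (i : ℕ) : (etaSeries p G i).Normal := (normal_aux p G i).1

theorem commutator_top_le (i : ℕ) : ⁅(⊤ : Subgroup G), etaSeries p G i⁆ ≤ etaSeries p G (i + 1) := by
  cases i with
  | zero => simp [etaSeries]
  | succ i => rw [succ_succ]; exact le_sup_left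

theorem pow_mem {i : ℕ} {x : G} (hx : x ∈ etaSeries p G i) : x ^ p ∈ etaSeries p G (i + 1) := by
  cases i with
  | zero => simp [etaSeries]
  | succ i =>
    rw [succ_succ]
    exact Subgroup.mem_sup_right (Subgroup.subset_closure ⟨x, hx, rfl⟩)

theorem succ_le (i : ℕ) : etaSeries p G (i + 1) ≤ etaSeries p G i := by
  cases i with
  | zero => simp [etaSeries]
  | succ i =>
    rw [succ_succ, sup_le_iff, Subgroup.closure_le]
    refine ⟨Subgroup.commutator_le_right _ _, ?_⟩
    rintro _ ⟨y, hy, rfl⟩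
    exact Subgroup.pow_mem _ hy p

theorem antitone : Antitone (etaSeries p G) := antitone_nat_of_succ_le (succ_le p G)

theorem commutator_le (i j : ℕ) :
    ⁅etaSeries p G i, etaSeries p G j⁆ ≤ etaSeries p G (i + j) := by
  induction i generalizing j with
  | zero => rw [zero_add]; exact Subgroup.commutator_le_right _ _
  | succ i ih =>
    cases i with
    | zero =>
      rw [zero_add, add_comm 1 j]
      exact (Subgroup.commutator_mono le_top le_rfl).trans (commutator_top_le p G j)
    | succ i =>
      have e : i + 1 + 1 + j = (i + 1 + j) + 1 := by omega
      rw [e]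
      set N := etaSeries p G ((i + 1 + j) + 1) with hN
      let f := QuotientGroup.mk' N
      have hker : ∀ {A B : Subgroup G}, ⁅A, B⁆ ≤ N → ⁅A.map f, B.map f⁆ = ⊥ := by
        intro A B h
        rw [← Subgroup.map_commutator, Subgroup.map_eq_bot_iff, QuotientGroup.ker_mk']
        exact h
      have h3 : ⁅⁅(⊤ : Subgroup G).map f, (etaSeries p G (i + 1)).map f⁆,
          (etaSeries p G j).map f⁆ = ⊥ := by
        apply Subgroup.commutator_commutator_eq_bot_of_rotate
        · rw [← Subgroup.map_commutator]
          refine hker ((Subgroup.commutator_mono (ih j) le_rfl).trans ?_)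
          rw [Subgroup.commutator_comm]
          exact commutator_top_le p G (i + 1 + j)
        · rw [← Subgroup.map_commutator]
          refine hker ?_
          rw [Subgroup.commutator_comm ⁅_, _⁆, Subgroup.commutator_comm (etaSeries p G j)]
          exact (Subgroup.commutator_mono le_rfl (commutator_top_le p G j)).trans (ih (j + 1))
      have key : etaSeries p G (i + 2) ≤
          (Subgroup.centralizer (((etaSeries p G j).map f : Subgroup (G ⧸ N)) :
            Set (G ⧸ N))).comap f := by
        rw [succ_succ, sup_le_iff]
        constructor
        · rw [← Subgroup.map_le_iff_le_comap, Subgroup.map_commutator]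
          exact Subgroup.commutator_eq_bot_iff_le_centralizer.1 h3
        · rw [Subgroup.closure_le]
          rintro _ ⟨x, hx, rfl⟩
          rw [SetLike.mem_coe, Subgroup.mem_comap, Subgroup.mem_centralizer_iff]
          rintro _ ⟨y, hy, rfl⟩
          have hz := ih j (Subgroup.commutator_mem_commutator hx hy)
          have hc : ∀ g : G, Commute (f g) (f ⁅x, y⁆) := by
            intro g
            rw [← commutatorElement_eq_one_iff_commute, ← map_commutatorElement]
            exact (QuotientGroup.eq_one_iff _).2 (commutator_top_le p G _
              (Subgroup.commutator_mem_commutator (Subgroup.mem_top g) hz))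
          have hp : f ⁅x, y⁆ ^ p = 1 := by
            rw [← map_pow]
            exact (QuotientGroup.eq_one_iff _).2 (pow_mem p G hz)
          have h1 : f y * f x * (f y)⁻¹ = f x * (f ⁅x, y⁆)⁻¹ := by
            rw [(hc x).inv_right.eq, map_commutatorElement, commutatorElement_def]
            group
          have h2 : (f y * f x * (f y)⁻¹) ^ p = f x ^ p := by
            rw [h1, (hc x).inv_right.mul_pow, inv_pow, hp, inv_one, mul_one]
          rw [conj_pow] at h2
          rw [map_pow]
          exact mul_inv_eq_iff_eq_mul.1 h2
      have h4 : ⁅(etaSeries p G (i + 2)).map f, (etaSeries p G j).map f⁆ = ⊥ :=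
        Subgroup.commutator_eq_bot_iff_le_centralizer.2 (Subgroup.map_le_iff_le_comap.2 key)
      rw [← Subgroup.map_commutator, Subgroup.map_eq_bot_iff, QuotientGroup.ker_mk'] at h4
      exact h4

end etaSeries

/-- The exponent-`p` central series of `G` as a filter on `ℕ`. -/
def etaFilter (p : ℕ) (G : Type*) [Group G] : GroupFilter G ℕ where
  toFun := etaSeries p G
  map_zero := by rw [etaSeries]
  commutator_le := etaSeries.commutator_le p G
  map_add_le s t := le_inf (etaSeries.antitone p G (Nat.le_add_right s t))
    (etaSeries.antitone p G (Nat.le_add_left t s))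

/-! Let F be the field of p elements, U = F^r, D = F^t with t ≤ 2, and R = F[x]/(x^7) with
augmentation ε : R → F. Each biadditive T : U × U → U is enlarged to β : A × C → W with A = U × R
and C = W = U × D × R (`augmentedBimap`), whose Heisenberg group has order p^(3r+2t+21). The added
summands force the required properties for every T, so no genericity argument is needed.

Length of η: β (0, 1) is the identity of C, so the commutators fill W, which is central of exponent
p. Hence η runs through G, W and 1, with L_1 = A × C.

Length of the refinement: let z multiply the R-summands by x and kill U and D. As ε x = 0, z passes
through β, so it lies in the centroid of the bracket. Nondegeneracy makes z central in the adjoint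
ring, and a central nilpotent element lies in J (`pow_apply_mem_componentRadical`). Since z^6 ≠ 0,
L_1 J^6 ≠ 0; as J is nilpotent, the L_1 J^i decrease strictly down to zero. Commutators lie in every
H_i, so each of (1,1), …, (1,6) counts towards the length (`le_seriesLength_adjointRefinement`).

Counting: there are p^(r^3) choices of T. An isomorphism onto a fixed group H determines T through
the images of 3r elements, so at most |H|^(3r) = p^(3rn) choices give the same class
(`card_constants_isomorphic_le`). With r ≈ n/3, the exponent r^3 - 3rn is about n^3/27 - n^2, well
above 2n^3/729 + n^2. -/

/-! ### Powers of the Jacobson radical and the chain L_s J^i -/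

/-- If z avoided a maximal left ideal I, then 1 = yz + i with i in I; but yz is nilpotent because y
and z commute, so i = 1 - yz would be a unit. -/
theorem mem_jacobson_of_isNilpotent_of_commute {A : Type*} [Ring A] {z : A} (hz : IsNilpotent z)
    (hc : ∀ a : A, Commute a z) : z ∈ Ring.jacobson A := by
  rw [Ring.jacobson_eq_sInf_isMaximal, Submodule.mem_sInf]
  intro I hI
  by_contra hzI
  obtain ⟨y, i, hi, h⟩ := hI.exists_inv hzI
  have hu : IsUnit i := by
    rw [show i = 1 - y * z by rw [← h]; abel]
    exact ((hc y).isNilpotent_mul_left hz).isUnit_one_sub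
  exact hI.ne_top (Ideal.eq_top_of_isUnit_mem I hi hu)

namespace GroupFilter

theorem radicalPower_succ (R : Type*) [Ring R] (i : ℕ) :
    radicalPower R (i + 1) = radicalPower R i * Ring.jacobson R := by
  simp only [radicalPower]
  exact Submodule.pow_succ _
theorem pow_mem_radicalPower {R : Type*} [Ring R] {z : R} (hz : z ∈ Ring.jacobson R) (i : ℕ) :
    z ^ i ∈ radicalPower R i := by
  induction i with
  | zero =>
    simp only [radicalPower]
    rw [Submodule.pow_zero, pow_zero]
    exact Submodule.one_le.1 le_rfl
  | succ i ih =>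
    rw [radicalPower_succ, pow_succ]
    exact Ideal.mul_mem_mul ih hz

theorem radicalPower_succ_le (R : Type*) [Ring R] (i : ℕ) :
    radicalPower R (i + 1) ≤ radicalPower R i := by
  induction i with
  | zero =>
    simp only [radicalPower]
    rw [Submodule.pow_zero]
    exact le_top.trans_eq Ideal.one_eq_top.symm
  | succ i ih =>
    rw [radicalPower_succ, radicalPower_succ R i]
    exact Ideal.mul_mono_left ih

theorem exists_radicalPower_eq_bot (R : Type*) [Ring R] [IsArtinianRing R] :
    ∃ N, radicalPower R N = ⊥ := by
  obtain ⟨N, hN⟩ := IsArtinianRing.isNilpotent_jacobson_bot (R := R)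
  refine ⟨N, ?_⟩
  rw [Ideal.jacobson_bot] at hN
  exact hN

section Radical

variable {G M : Type*} [Group G] [AddCommMonoid M] (φ : GroupFilter G M) (s : M) [NeZero s]

theorem unop_mem_componentRadical {i : ℕ} {a : φ.adjointRing s s}
    (ha : a ∈ radicalPower (φ.adjointRing s s) i) (u : φ.Component s) :
    a.1.1.unop u ∈ φ.componentRadical s i :=
  AddSubgroup.subset_closure ⟨u, a, ha, rfl⟩

theorem unop_mem_componentRadical_succ {i : ℕ} {c : φ.adjointRing s s}
    (hc : c ∈ Ring.jacobson (φ.adjointRing s s)) {u : φ.Component s}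
    (hu : u ∈ φ.componentRadical s i) : c.1.1.unop u ∈ φ.componentRadical s (i + 1) := by
  suffices h : φ.componentRadical s i ≤ (φ.componentRadical s (i + 1)).comap c.1.1.unop from h hu
  rw [componentRadical, AddSubgroup.closure_le]
  rintro _ ⟨v, b, hb, rfl⟩
  have hbc : b * c ∈ radicalPower (φ.adjointRing s s) (i + 1) := by
    rw [radicalPower_succ]
    exact Ideal.mul_mem_mul hb hc
  exact φ.unop_mem_componentRadical s hbc v

/-- Multiply the inclusion by J on the right: L_s J^(i+1) is generated by elements (v b) c with b in
J^i and c in J, since the ring acts from the right. -/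
theorem componentRadical_succ_le_of_le {i j : ℕ}
    (h : φ.componentRadical s i ≤ φ.componentRadical s j) :
    φ.componentRadical s (i + 1) ≤ φ.componentRadical s (j + 1) := by
  rw [componentRadical, AddSubgroup.closure_le]
  rintro _ ⟨v, b, hb, rfl⟩
  rw [radicalPower_succ] at hb
  rw [SetLike.mem_coe]
  induction hb using Submodule.smul_induction_on' with
  | smul b hb c hc =>
    exact φ.unop_mem_componentRadical_succ s hc (h (φ.unop_mem_componentRadical s hb v))
  | add b _ c _ hb hc => exact add_mem hb hc

theorem componentRadical_succ_le (i : ℕ) :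
    φ.componentRadical s (i + 1) ≤ φ.componentRadical s i := by
  rw [componentRadical, AddSubgroup.closure_le]
  rintro _ ⟨v, b, hb, rfl⟩
  exact φ.unop_mem_componentRadical s (radicalPower_succ_le _ i hb) v

theorem componentRadical_antitone : Antitone (φ.componentRadical s) :=
  antitone_nat_of_succ_le (φ.componentRadical_succ_le s)

theorem exists_componentRadical_eq_bot [Finite (φ.Component s)] :
    ∃ N, φ.componentRadical s N = ⊥ := by
  have : Finite (AddMonoid.End (φ.Component s)) := DFunLike.finite _
  have : Finite (AddMonoid.End (φ.Component s))ᵐᵒᵖ := Finite.of_equiv _ MulOpposite.opEquiv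
  have : Finite (φ.adjointRing s s) := Subtype.finite
  obtain ⟨N, hN⟩ := exists_radicalPower_eq_bot (φ.adjointRing s s)
  refine ⟨N, ?_⟩
  rw [componentRadical, AddSubgroup.closure_eq_bot_iff]
  rintro _ ⟨u, a, ha, rfl⟩
  rw [hN] at ha
  rw [(Submodule.mem_bot _).1 ha]
  rfl

/-- A Nakayama argument: if the chain stalls at i it is constant from there on, while the radical of
the finite adjoint ring is nilpotent. -/
theorem componentRadical_ne_succ [Finite (φ.Component s)] {i : ℕ}
    (h : φ.componentRadical s i ≠ ⊥) :
    φ.componentRadical s i ≠ φ.componentRadical s (i + 1) := by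
  intro he
  have hle : ∀ k, φ.componentRadical s i ≤ φ.componentRadical s (i + k) := by
    intro k
    induction k with
    | zero => exact le_rfl
    | succ k ih => exact he.le.trans (φ.componentRadical_succ_le_of_le s ih)
  obtain ⟨N, hN⟩ := φ.exists_componentRadical_eq_bot s
  refine h (le_bot_iff.1 ?_)
  rw [← hN]
  exact (hle N).trans (φ.componentRadical_antitone s (Nat.le_add_left N i))

theorem componentRadical_le_of_radicalSubgroup_le {i j : ℕ}
    (h : φ.radicalSubgroup s i ≤ φ.radicalSubgroup s j) :
    φ.componentRadical s i ≤ φ.componentRadical s j := by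
  intro u hu
  obtain ⟨x, rfl⟩ := φ.toComponent_surjective s u
  obtain ⟨hx, hx'⟩ := h (show (x : G) ∈ φ.radicalSubgroup s i from ⟨x.2, hu⟩)
  exact hx'

theorem radicalSubgroup_antitone : Antitone (φ.radicalSubgroup s) := by
  rintro i j hij x ⟨hx, hx'⟩
  exact ⟨hx, φ.componentRadical_antitone s hij hx'⟩

theorem boundary_le_radicalSubgroup (hle : φ.boundary s ≤ φ s) (i : ℕ) :
    φ.boundary s ≤ φ.radicalSubgroup s i := by
  intro x hx
  refine ⟨hle hx, ?_⟩
  have h : φ.toComponent s ⟨x, hle hx⟩ = φ.toComponent s 1 := by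
    rw [toComponent_eq_iff]
    simpa using hx
  rw [h]
  exact zero_mem _

end Radical

end GroupFilter

/-! ### A lower bound for the length of the adjoint refinement -/

theorem iteratedCommutator_le_commutator {G : Type*} [Group G] {l : List (Subgroup G)}
    (hl : 2 ≤ l.length) : iteratedCommutator l ≤ ⁅(⊤ : Subgroup G), ⊤⁆ := by
  match l with
  | [] => simp at hl
  | [_] => simp at hl
  | A :: B :: l =>
    clear hl
    suffices h : ∀ (l : List (Subgroup G)) (C : Subgroup G), C ≤ ⁅(⊤ : Subgroup G), ⊤⁆ →
        l.foldl (fun B C => ⁅B, C⁆) C ≤ ⁅(⊤ : Subgroup G), ⊤⁆ from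
      h l ⁅A, B⁆ (Subgroup.commutator_mono le_top le_top)
    clear A B l
    intro l
    induction l with
    | nil => exact fun C hC => hC
    | cons D l ih => exact fun C _ => ih _ (Subgroup.commutator_mono le_top le_top)

section AdjointRefinement

variable {G : Type*} [Group G] (φ : GroupFilter G ℕ)

theorem radicalSubgroup_le_adjointRefinement {i : ℕ} (hi : i ≠ 0) :
    φ.radicalSubgroup 1 i ≤ adjointRefinement φ 1 (1, i) := by
  have hmem : [((1 : ℕ), i)] ≠ [] ∧
      (∀ x ∈ [((1 : ℕ), i)], x ∈ {x : ℕ × ℕ | toLex x < toLex (1 + 1, 0)}) ∧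
      [((1 : ℕ), i)].sum = (1, i) := by
    refine ⟨by simp, ?_, by simp⟩
    simp [Prod.Lex.toLex_lt_toLex]
  unfold adjointRefinement generatedSeries
  refine le_iSup_of_le [(1, i)] (le_iSup_of_le hmem ?_)
  simp [iteratedCommutator, hi]

/-- Generators have first coordinate at most 1, so a one-term sequence occurs only for u = 1 and
contributes H_j ≤ H_i. Longer sequences give commutators, which `hb` places in every H_k. -/
theorem adjointRefinement_le_radicalSubgroup {i u j : ℕ} (hi : i ≠ 0)
    (hb : ∀ k, ⁅(⊤ : Subgroup G), ⊤⁆ ≤ φ.radicalSubgroup 1 k)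
    (h : u = 1 ∧ i ≤ j ∨ 2 ≤ u) :
    adjointRefinement φ 1 (u, j) ≤ φ.radicalSubgroup 1 i := by
  refine iSup₂_le fun l hl => ?_
  obtain ⟨hne, hX, hsum⟩ := hl
  match l, hne with
  | [x], _ =>
    have hx := hX x (by simp)
    simp only [Set.mem_ofPred_eq, Prod.Lex.toLex_lt_toLex] at hx
    simp only [List.sum_singleton] at hsum
    subst hsum
    have h1 : u = 1 := by simp at hx; omega
    have h2 : i ≤ j := by omega
    subst h1
    have h3 : ¬ (j = 0) := by omega
    simpa [iteratedCommutator, h3] using φ.radicalSubgroup_antitone 1 h2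
  | x :: y :: l, _ =>
    exact (iteratedCommutator_le_commutator (by simp)).trans (hb i)

theorem le_seriesLength_adjointRefinement {m : ℕ} [Finite (φ.Component 1)]
    (hle : φ.boundary 1 ≤ φ 1) (hb : ⁅(⊤ : Subgroup G), ⊤⁆ ≤ φ.boundary 1)
    (hm : φ.componentRadical 1 m ≠ ⊥) : (m : ℕ∞) ≤ seriesLength (adjointRefinement φ 1) := by
  have hb' : ∀ k, ⁅(⊤ : Subgroup G), ⊤⁆ ≤ φ.radicalSubgroup 1 k := fun k =>
    hb.trans (φ.boundary_le_radicalSubgroup 1 hle k)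
  have hinj : Function.Injective (fun i : Fin m => ((1 : ℕ), (i : ℕ) + 1)) := by
    intro i j h
    simpa [Fin.ext_iff] using h
  calc (m : ℕ∞) = (Set.range (fun i : Fin m => ((1 : ℕ), (i : ℕ) + 1))).encard := by
        rw [← Set.image_univ, hinj.encard_image]
        simp
    _ ≤ seriesLength (adjointRefinement φ 1) := by
        refine Set.encard_le_encard ?_
        rintro _ ⟨i, rfl⟩
        refine ⟨by simp, fun he => ?_⟩
        -- The value at (1, i + 1) contains H_(i+1), while its boundary lies in H_(i+2): a nonzero
        -- shift raises the second coordinate or makes the first at least 2. Equality would stall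
        -- the chain. The shift to i + 1 avoids second coordinate 0, where the generating function
        -- is φ_1 instead.
        have h1 : φ.radicalSubgroup 1 (i + 1) ≤ φ.radicalSubgroup 1 (i + 1 + 1) := by
          refine (radicalSubgroup_le_adjointRefinement φ (Nat.succ_ne_zero i)).trans ?_
          rw [← he]
          refine iSup₂_le fun t ht => ?_
          obtain ⟨a, b⟩ := t
          refine adjointRefinement_le_radicalSubgroup φ (Nat.succ_ne_zero _) hb' ?_
          rw [Ne, Prod.mk_eq_zero] at ht
          dsimp only
          omega
        have hne : φ.componentRadical 1 (i + 1) ≠ ⊥ := fun h0 => hm (le_bot_iff.1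
          (h0 ▸ φ.componentRadical_antitone 1 (Nat.succ_le_of_lt i.2)))
        exact φ.componentRadical_ne_succ 1 hne (le_antisymm
          (φ.componentRadical_le_of_radicalSubgroup_le 1 h1) (φ.componentRadical_succ_le 1 _))

end AdjointRefinement

/-! ### Heisenberg groups and their η series -/

/-- The generalised Heisenberg group of a biadditive map `β : A × C → W`: the set `A × C × W` with
`(a, c, w) (a', c', w') = (a + a', c + c', w + w' + β a c')`. -/
@[ext]
structure HeisenbergGroup {A C W : Type*} [AddCommGroup A] [AddCommGroup C] [AddCommGroup W]
    (β : A →+ C →+ W) where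
  left : A
  right : C
  central : W

namespace HeisenbergGroup

open scoped commutatorElement

section Group

variable {A C W : Type*} [AddCommGroup A] [AddCommGroup C] [AddCommGroup W] {β : A →+ C →+ W}

instance : Mul (HeisenbergGroup β) :=
  ⟨fun x y => ⟨x.left + y.left, x.right + y.right, x.central + y.central + β x.left y.right⟩⟩

instance : One (HeisenbergGroup β) := ⟨⟨0, 0, 0⟩⟩

instance : Inv (HeisenbergGroup β) :=
  ⟨fun x => ⟨-x.left, -x.right, -x.central + β x.left x.right⟩⟩

@[simp] theorem mul_left (x y : HeisenbergGroup β) : (x * y).left = x.left + y.left := rfl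
@[simp] theorem mul_right (x y : HeisenbergGroup β) : (x * y).right = x.right + y.right := rfl
@[simp] theorem mul_central (x y : HeisenbergGroup β) :
    (x * y).central = x.central + y.central + β x.left y.right := rfl
@[simp] theorem one_left : (1 : HeisenbergGroup β).left = 0 := rfl
@[simp] theorem one_right : (1 : HeisenbergGroup β).right = 0 := rfl
@[simp] theorem one_central : (1 : HeisenbergGroup β).central = 0 := rfl
@[simp] theorem inv_left (x : HeisenbergGroup β) : x⁻¹.left = -x.left := rfl
@[simp] theorem inv_right (x : HeisenbergGroup β) : x⁻¹.right = -x.right := rfl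
@[simp] theorem inv_central (x : HeisenbergGroup β) :
    x⁻¹.central = -x.central + β x.left x.right := rfl

instance : Group (HeisenbergGroup β) :=
  Group.ofLeftAxioms
    (fun x y z => by ext <;> simp <;> abel)
    (fun x => by ext <;> simp)
    (fun x => by ext <;> simp)

theorem commutator_eq (x y : HeisenbergGroup β) :
    ⁅x, y⁆ = ⟨0, 0, β x.left y.right - β y.left x.right⟩ := by
  rw [commutatorElement_def]
  ext <;> simp; abel

variable (β) in
/-- The projection of the group onto `A × C`. -/
def proj : HeisenbergGroup β →* Multiplicative (A × C) where
  toFun x := Multiplicative.ofAdd (x.left, x.right)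
  map_one' := rfl
  map_mul' _ _ := rfl

theorem mem_ker_proj {x : HeisenbergGroup β} :
    x ∈ (proj β).ker ↔ x.left = 0 ∧ x.right = 0 := by
  rw [MonoidHom.mem_ker]
  exact Multiplicative.ofAdd.injective.eq_iff.trans Prod.mk_eq_zero

variable (β) in
/-- The embedding of `W` as a central subgroup. -/
def centralHom : W →+ Additive (HeisenbergGroup β) where
  toFun w := Additive.ofMul ⟨0, 0, w⟩
  map_zero' := rfl
  map_add' v w := by
    refine congrArg Additive.ofMul ?_
    ext <;> simp

/-- The group is, as a set, `A × C × W`. -/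
def equivProd : HeisenbergGroup β ≃ A × C × W where
  toFun x := (x.left, x.right, x.central)
  invFun x := ⟨x.1, x.2.1, x.2.2⟩
  left_inv _ := rfl
  right_inv _ := rfl

instance [Finite A] [Finite C] [Finite W] : Finite (HeisenbergGroup β) :=
  Finite.of_equiv _ equivProd.symm

theorem natCard : Nat.card (HeisenbergGroup β) = Nat.card A * (Nat.card C * Nat.card W) := by
  rw [Nat.card_congr equivProd, Nat.card_prod, Nat.card_prod]

variable {p : ℕ}

theorem pow_mem_ker_proj (hA : ∀ a : A, p • a = 0) (hC : ∀ c : C, p • c = 0)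
    (x : HeisenbergGroup β) : x ^ p ∈ (proj β).ker := by
  rw [MonoidHom.mem_ker, map_pow]
  exact congrArg Multiplicative.ofAdd (Prod.ext (hA x.left) (hC x.right))

theorem pow_eq_one_of_mem_ker_proj (hW : ∀ w : W, p • w = 0) {x : HeisenbergGroup β}
    (hx : x ∈ (proj β).ker) : x ^ p = 1 := by
  obtain ⟨a, c, w⟩ := x
  obtain ⟨rfl, rfl⟩ := mem_ker_proj.1 hx
  have h := map_nsmul (centralHom β) p w
  rw [hW, map_zero] at h
  exact h.symm

theorem commutator_eq_one_of_mem_ker_proj (x : HeisenbergGroup β) {y : HeisenbergGroup β}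
    (hy : y ∈ (proj β).ker) : ⁅x, y⁆ = 1 := by
  obtain ⟨h1, h2⟩ := mem_ker_proj.1 hy
  rw [commutator_eq, h1, h2]
  ext <;> simp

theorem commutator_mem_ker_proj (x y : HeisenbergGroup β) : ⁅x, y⁆ ∈ (proj β).ker := by
  rw [commutator_eq, mem_ker_proj]
  exact ⟨rfl, rfl⟩

/-- The commutators of (e, 0, 0) with the elements (0, c, 0) already exhaust W, so p-th powers only
need to lie in W. This makes p = 2 no exception. -/
theorem eta_two (hA : ∀ a : A, p • a = 0) (hC : ∀ c : C, p • c = 0)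
    {e : A} (he : Function.Surjective (β e)) :
    etaSeries p (HeisenbergGroup β) 2 = (proj β).ker := by
  rw [etaSeries.succ_succ, zero_add, etaSeries]
  refine le_antisymm (sup_le ?_ ?_) fun x hx => Subgroup.mem_sup_left ?_
  · rw [Subgroup.commutator_le]
    exact fun x _ y _ => commutator_mem_ker_proj x y
  · rw [Subgroup.closure_le]
    rintro _ ⟨y, -, rfl⟩
    exact pow_mem_ker_proj hA hC y
  · obtain ⟨a, c, w⟩ := x
    obtain ⟨rfl, rfl⟩ := mem_ker_proj.1 hx
    obtain ⟨c, rfl⟩ := he w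
    have h := Subgroup.commutator_mem_commutator (Subgroup.mem_top (⟨e, 0, 0⟩ : HeisenbergGroup β))
      (Subgroup.mem_top (⟨0, c, 0⟩ : HeisenbergGroup β))
    rw [commutator_eq] at h
    simpa using h

theorem eta_three (hA : ∀ a : A, p • a = 0) (hC : ∀ c : C, p • c = 0) (hW : ∀ w : W, p • w = 0)
    {e : A} (he : Function.Surjective (β e)) : etaSeries p (HeisenbergGroup β) 3 = ⊥ := by
  rw [etaSeries.succ_succ, one_add_one_eq_two, eta_two hA hC he, eq_bot_iff, sup_le_iff]
  constructor
  · rw [Subgroup.commutator_le]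
    exact fun x _ y hy => commutator_eq_one_of_mem_ker_proj x hy
  · rw [Subgroup.closure_le]
    rintro _ ⟨y, hy, rfl⟩
    exact pow_eq_one_of_mem_ker_proj hW hy

end Group

end HeisenbergGroup

theorem etaFilter_boundary (p : ℕ) (G : Type*) [Group G] (s : ℕ) :
    (etaFilter p G).boundary s = etaSeries p G (s + 1) := by
  refine le_antisymm (iSup₂_le fun t ht => etaSeries.antitone p G (by omega)) ?_
  exact (etaFilter p G).le_boundary s one_ne_zero

theorem seriesLength_etaFilter_eq_two {p : ℕ} {G : Type*} [Group G] (h2 : etaSeries p G 2 ≠ ⊤)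
    (h2' : etaSeries p G 2 ≠ ⊥) (h3 : etaSeries p G 3 = ⊥) :
    seriesLength (etaFilter p G) = 2 := by
  have h : {s : ℕ | s ≠ 0 ∧ seriesBoundary (etaFilter p G) s ≠ etaFilter p G s} = {1, 2} := by
    ext s
    change s ≠ 0 ∧ (etaFilter p G).boundary s ≠ etaSeries p G s ↔ _
    rw [etaFilter_boundary]
    match s with
    | 0 => simp
    | 1 => simpa [etaSeries] using h2
    | 2 => simpa [h3] using h2'.symm
    | s + 3 =>
      have h4 : ∀ k, etaSeries p G (k + 3) = ⊥ := fun k =>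
        le_bot_iff.1 (h3 ▸ etaSeries.antitone p G (by omega))
      simp [h4 s, show s + 3 + 1 = s + 1 + 3 by ring, h4 (s + 1)]
  rw [seriesLength, h]
  exact Set.encard_pair (by norm_num)

/-! ### Centroid elements in the radical of the adjoint ring -/

namespace GroupFilter

section Centroid

variable {G M : Type*} [Group G] [AddCommMonoid M] (φ : GroupFilter G M) (s : M) [NeZero s]

/-- A self-adjoint additive endomorphism, as an element of the adjoint ring. -/
def adjointRingMk (z : AddMonoid.End (φ.Component s))
    (hz : ∀ u v, φ.bracket s s (z u) v = φ.bracket s s u (z v)) : φ.adjointRing s s :=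
  ⟨(MulOpposite.op z, z), hz⟩

/-- If the bracket `L_s × L_s → L_{s+s}` is nondegenerate, then a nilpotent endomorphism `z` in its
centroid lies in the radical of the adjoint ring, so that `z ^ m` maps `L_s` to `L_s J^m`. -/
theorem pow_apply_mem_componentRadical (z : AddMonoid.End (φ.Component s))
    (hl : ∀ u u', (∀ v, φ.bracket s s u v = φ.bracket s s u' v) → u = u')
    (hr : ∀ v v', (∀ u, φ.bracket s s u v = φ.bracket s s u v') → v = v')
    (hz : ∀ u v, φ.bracket s s (z u) v = φ.bracket s s u (z v))
    (hz' : ∀ u v u' v', φ.bracket s s u v = φ.bracket s s u' v' →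
      φ.bracket s s (z u) v = φ.bracket s s (z u') v')
    (hn : IsNilpotent z) (m : ℕ) (u : φ.Component s) :
    (z ^ m) u ∈ φ.componentRadical s m := by
  set a := φ.adjointRingMk s z hz with ha
  have hpow : ∀ k, (a ^ k).1 = (MulOpposite.op (z ^ k), z ^ k) := fun k => by
    rw [Subring.coe_pow]
    exact Prod.ext (MulOpposite.op_pow z k).symm rfl
  have hnil : IsNilpotent a := by
    obtain ⟨k, hk⟩ := hn
    refine ⟨k, Subtype.ext ?_⟩
    rw [hpow, hk]
    rfl
  -- For (X, Y) adjoint, [z X u, v] and [z u, Y v] agree because [X u, v] = [u, Y v]; the latter is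
  -- [X z u, v]. Nondegeneracy gives z X = X z, and symmetrically z Y = Y z.
  have hcomm : ∀ b : φ.adjointRing s s, Commute b a := by
    rintro ⟨⟨X, Y⟩, hXY⟩
    have hXY : ∀ u v, φ.bracket s s (X.unop u) v = φ.bracket s s u (Y v) := hXY
    refine Subtype.ext (Prod.ext (MulOpposite.unop_injective ?_) ?_)
    · refine AddMonoidHom.ext fun u => hl _ _ fun v => ?_
      change φ.bracket s s (z (X.unop u)) v = φ.bracket s s (X.unop (z u)) v
      rw [hXY, hz' _ _ _ _ (hXY u v)]
    · refine AddMonoidHom.ext fun v => hr _ _ fun u => ?_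
      change φ.bracket s s u (Y (z v)) = φ.bracket s s u (z (Y v))
      rw [← hXY, ← hz, ← hz, hz' _ _ _ _ (hXY u v)]
  have hmem := φ.unop_mem_componentRadical s
    (pow_mem_radicalPower (mem_jacobson_of_isNilpotent_of_commute hnil hcomm) m) u
  rwa [hpow] at hmem

end Centroid

end GroupFilter

/-! ### The adjoint refinement for Heisenberg groups -/

namespace HeisenbergGroup

section Refinement

variable {A C W : Type*} [AddCommGroup A] [AddCommGroup C] [AddCommGroup W] {β : A →+ C →+ W}
  {p : ℕ}

theorem etaFilter_boundary_one (hA : ∀ a : A, p • a = 0) (hC : ∀ c : C, p • c = 0) {e : A}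
    (he : Function.Surjective (β e)) :
    (etaFilter p (HeisenbergGroup β)).boundary 1 = (proj β).ker := by
  rw [etaFilter_boundary]
  exact eta_two hA hC he

theorem mem_etaFilter_one (x : HeisenbergGroup β) : x ∈ etaFilter p (HeisenbergGroup β) 1 := by
  change x ∈ etaSeries p _ 1
  rw [etaSeries]
  trivial

/-- The class in the first component of the `η` series of an element of the group. -/
def toComponentOne (p : ℕ) (x : HeisenbergGroup β) :
    (etaFilter p (HeisenbergGroup β)).Component 1 :=
  (etaFilter p (HeisenbergGroup β)).toComponent 1 ⟨x, mem_etaFilter_one x⟩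

theorem toComponentOne_surjective (u : (etaFilter p (HeisenbergGroup β)).Component 1) :
    ∃ x : HeisenbergGroup β, toComponentOne p x = u := by
  obtain ⟨x, rfl⟩ := (etaFilter p (HeisenbergGroup β)).toComponent_surjective 1 u
  exact ⟨x.1, rfl⟩

theorem toComponentOne_mul (x y : HeisenbergGroup β) :
    toComponentOne p (x * y) = toComponentOne p x + toComponentOne p y := rfl

theorem toComponentOne_eq_iff (hA : ∀ a : A, p • a = 0) (hC : ∀ c : C, p • c = 0) {e : A}
    (he : Function.Surjective (β e)) (x y : HeisenbergGroup β) :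
    toComponentOne p x = toComponentOne p y ↔ x.left = y.left ∧ x.right = y.right := by
  rw [toComponentOne, toComponentOne, GroupFilter.toComponent_eq_iff,
    etaFilter_boundary_one hA hC he, mem_ker_proj]
  simp [neg_add_eq_zero]

/-- Since η_3 is trivial, classes in L_2 agree exactly when the commutators do. Comparing two
brackets avoids identifying L_2 with W. -/
theorem bracket_toComponentOne_eq_iff (hA : ∀ a : A, p • a = 0) (hC : ∀ c : C, p • c = 0)
    (hW : ∀ w : W, p • w = 0) {e : A} (he : Function.Surjective (β e))
    (x y x' y' : HeisenbergGroup β) :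
    (etaFilter p (HeisenbergGroup β)).bracket 1 1 (toComponentOne p x) (toComponentOne p y) =
      (etaFilter p (HeisenbergGroup β)).bracket 1 1 (toComponentOne p x') (toComponentOne p y') ↔
    β x.left y.right - β y.left x.right = β x'.left y'.right - β y'.left x'.right := by
  rw [toComponentOne, toComponentOne, toComponentOne, toComponentOne,
    GroupFilter.bracket_toComponent, GroupFilter.bracket_toComponent,
    GroupFilter.toComponent_eq_iff, etaFilter_boundary, eta_three hA hC hW he, Subgroup.mem_bot,
    inv_mul_eq_one]
  simp only [commutator_eq, HeisenbergGroup.mk.injEq, true_and]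

/-- The first component of the `η` series is `A × C`. -/
noncomputable def componentOneEquiv (hA : ∀ a : A, p • a = 0) (hC : ∀ c : C, p • c = 0) {e : A}
    (he : Function.Surjective (β e)) :
    A × C ≃+ (etaFilter p (HeisenbergGroup β)).Component 1 :=
  AddEquiv.ofBijective
    (AddMonoidHom.mk' (fun x => toComponentOne p (⟨x.1, x.2, 0⟩ : HeisenbergGroup β))
      (fun x y => ((toComponentOne_eq_iff hA hC he
        ⟨(x + y).1, (x + y).2, 0⟩ ((⟨x.1, x.2, 0⟩ : HeisenbergGroup β) * ⟨y.1, y.2, 0⟩)).2 ⟨rfl, rfl⟩).trans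
        (toComponentOne_mul _ _)))
    ⟨fun x y h => by
      obtain ⟨h1, h2⟩ := (toComponentOne_eq_iff hA hC he _ _).1 h
      exact Prod.ext h1 h2,
    fun u => by
      obtain ⟨x, rfl⟩ := toComponentOne_surjective u
      exact ⟨(x.left, x.right), (toComponentOne_eq_iff hA hC he _ _).2 ⟨rfl, rfl⟩⟩⟩

theorem componentOneEquiv_apply (hA : ∀ a : A, p • a = 0) (hC : ∀ c : C, p • c = 0) {e : A}
    (he : Function.Surjective (β e)) (x : A × C) :
    componentOneEquiv hA hC he x = toComponentOne p ⟨x.1, x.2, 0⟩ := rfl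

theorem bracket_componentOneEquiv_eq_iff (hA : ∀ a : A, p • a = 0) (hC : ∀ c : C, p • c = 0)
    (hW : ∀ w : W, p • w = 0) {e : A} (he : Function.Surjective (β e)) (x y x' y' : A × C) :
    (etaFilter p (HeisenbergGroup β)).bracket 1 1 (componentOneEquiv hA hC he x)
        (componentOneEquiv hA hC he y) =
      (etaFilter p (HeisenbergGroup β)).bracket 1 1 (componentOneEquiv hA hC he x')
        (componentOneEquiv hA hC he y') ↔
    β x.1 y.2 - β y.1 x.2 = β x'.1 y'.2 - β y'.1 x'.2 :=
  by simp only [componentOneEquiv_apply]; exact bracket_toComponentOne_eq_iff hA hC hW he _ _ _ _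

theorem le_seriesLength_adjointRefinement [Finite A] [Finite C]
    (hA : ∀ a : A, p • a = 0) (hC : ∀ c : C, p • c = 0) (hW : ∀ w : W, p • w = 0) {e : A}
    (he : Function.Bijective (β e)) {g : C} (hg : ∀ a, β a g = 0 → a = 0)
    (zA : AddMonoid.End A) (zC : AddMonoid.End C) (zW : AddMonoid.End W)
    (hzA : ∀ a c, β (zA a) c = zW (β a c)) (hzC : ∀ a c, β a (zC c) = zW (β a c))
    {m : ℕ} (hm : zA ^ m ≠ 0) (hnA : IsNilpotent zA) (hnC : IsNilpotent zC) :
    (m : ℕ∞) ≤ seriesLength (adjointRefinement (etaFilter p (HeisenbergGroup β)) 1) := by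
  set φ := etaFilter p (HeisenbergGroup β) with hφ
  let E := componentOneEquiv hA hC he.surjective
  have hE : ∀ x y x' y' : A × C, φ.bracket 1 1 (E x) (E y) = φ.bracket 1 1 (E x') (E y') ↔
      β x.1 y.2 - β y.1 x.2 = β x'.1 y'.2 - β y'.1 x'.2 :=
    bracket_componentOneEquiv_eq_iff hA hC hW he.surjective
  let z : AddMonoid.End (φ.Component 1) :=
    (E.toAddMonoidHom.comp (AddMonoidHom.prodMap zA zC)).comp E.symm.toAddMonoidHom
  have hzE : ∀ x, z (E x) = E (zA x.1, zC x.2) := fun x => by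
    change E (AddMonoidHom.prodMap zA zC (E.symm (E x))) = _
    rw [E.symm_apply_apply]
    rfl
  have hpow : ∀ k x, (z ^ k) (E x) = E ((zA ^ k) x.1, (zC ^ k) x.2) := by
    intro k
    induction k with
    | zero => exact fun x => rfl
    | succ k ih =>
      intro x
      rw [pow_succ, pow_succ, pow_succ]
      change (z ^ k) (z (E x)) = E ((zA ^ k) (zA x.1), (zC ^ k) (zC x.2))
      rw [hzE, ih]
  have hnil : IsNilpotent z := by
    obtain ⟨i, hi⟩ := hnA
    obtain ⟨j, hj⟩ := hnC
    refine ⟨i + j, AddMonoidHom.ext fun u => ?_⟩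
    obtain ⟨x, rfl⟩ := E.surjective u
    refine (hpow _ x).trans ?_
    rw [pow_add, hi, zero_mul, pow_add, hj, mul_zero]
    exact map_zero E
  -- Pairing with (0, g) detects the A-coordinate, and pairing with (e, 0) the C-coordinate.
  have hl : ∀ u u', (∀ v, φ.bracket 1 1 u v = φ.bracket 1 1 u' v) → u = u' := by
    intro u u' h
    obtain ⟨x, rfl⟩ := E.surjective u
    obtain ⟨x', rfl⟩ := E.surjective u'
    have h1 := (hE _ _ _ _).1 (h (E (0, g)))
    have h2 := (hE _ _ _ _).1 (h (E (e, 0)))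
    simp only [map_zero, AddMonoidHom.zero_apply, sub_zero, zero_sub, neg_inj] at h1 h2
    refine congrArg E (Prod.ext ?_ (he.injective h2))
    refine sub_eq_zero.1 (hg _ ?_)
    rw [map_sub, AddMonoidHom.sub_apply, h1, sub_self]
  have hswap : ∀ u v u' v', φ.bracket 1 1 u v = φ.bracket 1 1 u' v' →
      φ.bracket 1 1 v u = φ.bracket 1 1 v' u' := by
    intro u v u' v' h
    obtain ⟨x, rfl⟩ := E.surjective u
    obtain ⟨y, rfl⟩ := E.surjective v
    obtain ⟨x', rfl⟩ := E.surjective u'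
    obtain ⟨y', rfl⟩ := E.surjective v'
    rw [hE] at h ⊢
    rw [← neg_sub, h, neg_sub]
  have hmem : ∀ u, (z ^ m) u ∈ φ.componentRadical 1 m := by
    refine φ.pow_apply_mem_componentRadical 1 z hl
      (fun v v' h => hl v v' fun u => hswap _ _ _ _ (h u)) ?_ ?_ hnil m
    · intro u v
      obtain ⟨x, rfl⟩ := E.surjective u
      obtain ⟨y, rfl⟩ := E.surjective v
      rw [hzE, hzE, hE]
      simp only [hzA, hzC]
    · intro u v u' v' h
      obtain ⟨x, rfl⟩ := E.surjective u
      obtain ⟨y, rfl⟩ := E.surjective v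
      obtain ⟨x', rfl⟩ := E.surjective u'
      obtain ⟨y', rfl⟩ := E.surjective v'
      rw [hzE, hzE]
      rw [hE] at h ⊢
      simp only [hzA, hzC]
      rw [← map_sub, h, map_sub]
  have : Finite (φ.Component 1) := Finite.of_equiv _ E.toEquiv
  refine _root_.le_seriesLength_adjointRefinement φ (fun x _ => mem_etaFilter_one x) ?_ ?_
  · rw [etaFilter_boundary_one hA hC he.surjective, Subgroup.commutator_le]
    exact fun x _ y _ => commutator_mem_ker_proj x y
  · intro h0
    refine hm (AddMonoidHom.ext fun a => ?_)
    have h := hmem (E (a, 0))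
    rw [h0, AddSubgroup.mem_bot, hpow, EmbeddingLike.map_eq_zero_iff] at h
    exact congrArg Prod.fst h

theorem isLexLeastAdjointRefinement [Nontrivial A] (hA : ∀ a : A, p • a = 0)
    (hC : ∀ c : C, p • c = 0) {e : A} (he : Function.Surjective (β e)) :
    IsLexLeastAdjointRefinement (etaFilter p (HeisenbergGroup β))
      (adjointRefinement (etaFilter p (HeisenbergGroup β)) 1) := by
  refine ⟨1, inferInstance, ⟨⟨one_ne_zero, fun h => ?_⟩, fun t ht =>
    Nat.one_le_iff_ne_zero.2 ht.1⟩, rfl⟩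
  obtain ⟨a, ha⟩ := exists_ne (0 : A)
  have hx := mem_etaFilter_one (p := p) (⟨a, 0, 0⟩ : HeisenbergGroup β)
  rw [← h, etaFilter_boundary_one hA hC he, mem_ker_proj] at hx
  exact ha hx.1

theorem seriesLength_etaFilter [Nontrivial A] [Nontrivial W] (hA : ∀ a : A, p • a = 0)
    (hC : ∀ c : C, p • c = 0) (hW : ∀ w : W, p • w = 0) {e : A}
    (he : Function.Surjective (β e)) :
    seriesLength (etaFilter p (HeisenbergGroup β)) = 2 := by
  obtain ⟨a, ha⟩ := exists_ne (0 : A)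
  obtain ⟨w, hw⟩ := exists_ne (0 : W)
  refine seriesLength_etaFilter_eq_two ?_ ?_ (eta_three hA hC hW he) <;> rw [eta_two hA hC he]
  · intro h
    have hx : (⟨a, 0, 0⟩ : HeisenbergGroup β) ∈ (proj β).ker := h ▸ Subgroup.mem_top _
    exact ha (mem_ker_proj.1 hx).1
  · intro h
    have hx : (⟨0, 0, w⟩ : HeisenbergGroup β) ∈ (proj β).ker := mem_ker_proj.2 ⟨rfl, rfl⟩
    rw [h, Subgroup.mem_bot] at hx
    exact hw (congrArg HeisenbergGroup.central hx)

end Refinement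

end HeisenbergGroup

/-! ### Pigeonhole on isomorphism classes and structure constants -/

/-- If each isomorphism class in a finite family of groups has at most `B` members, then there are
at least `|ι| / B` classes. -/
theorem exists_pairwise_nonisomorphic {ι : Type*} [Finite ι] (G : ι → Type*) [∀ i, Group (G i)]
    (B : ℕ) (hB : ∀ i, Nat.card {j // Nonempty (G j ≃* G i)} ≤ B) :
    ∃ (k : ℕ) (f : Fin k → ι), Nat.card ι ≤ B * k ∧
      ∀ i j, i ≠ j → IsEmpty (G (f i) ≃* G (f j)) := by
  classical
  have := Fintype.ofFinite ι
  let S : Setoid ι := ⟨fun i j => Nonempty (G i ≃* G j), fun i => ⟨MulEquiv.refl _⟩,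
    fun ⟨e⟩ => ⟨e.symm⟩, fun ⟨e⟩ ⟨e'⟩ => ⟨e.trans e'⟩⟩
  have hfin : Finite (Quotient S) := Quotient.finite S
  let E := (Finite.equivFin (Quotient S)).symm
  have hiso : ∀ i j, (⟦i⟧ : Quotient S) = ⟦j⟧ ↔ Nonempty (G i ≃* G j) := fun i j => Quotient.eq
  refine ⟨Nat.card (Quotient S), fun i => (E i).out, ?_, fun i j hij => ?_⟩
  · have := Fintype.ofFinite (Quotient S)
    have h := Finset.card_le_mul_card_image (f := fun i : ι => (⟦i⟧ : Quotient S)) Finset.univ B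
      (by
        intro q _
        obtain ⟨i, rfl⟩ := Quotient.exists_rep q
        refine le_trans (le_of_eq ?_) (hB i)
        rw [Nat.card_eq_fintype_card, Fintype.card_subtype]
        simp only [hiso])
    rw [Nat.card_eq_fintype_card, Nat.card_eq_fintype_card]
    exact h.trans (Nat.mul_le_mul_left B (Finset.card_le_univ _))
  · rw [← not_nonempty_iff, ← hiso, Quotient.out_eq, Quotient.out_eq]
    exact fun h => hij (E.injective h)

/-- The biadditive map on `F ^ r` with structure constants `t`. -/
def biadditiveOfConstants {F : Type*} [CommRing F] {r : ℕ} (t : Fin r → Fin r → Fin r → F) :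
    (Fin r → F) →+ (Fin r → F) →+ (Fin r → F) :=
  AddMonoidHom.mk' (fun a => AddMonoidHom.mk' (fun c k => ∑ i, ∑ j, a i * c j * t i j k)
    (fun c c' => by
      ext k
      simp only [Pi.add_apply, mul_add, add_mul, Finset.sum_add_distrib]))
    (fun a a' => AddMonoidHom.ext fun c => funext fun k => by
      simp only [AddMonoidHom.mk'_apply, AddMonoidHom.add_apply, Pi.add_apply, add_mul,
        Finset.sum_add_distrib])

theorem biadditiveOfConstants_single {F : Type*} [CommRing F] {r : ℕ}
    (t : Fin r → Fin r → Fin r → F) (i j : Fin r) :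
    biadditiveOfConstants t (Pi.single i 1) (Pi.single j 1) = t i j := by
  ext k
  simp [biadditiveOfConstants, Pi.single_apply]

/-! ### The augmented bimap -/

section Bimap

variable {F R U D : Type*} [CommRing F] [CommRing R] [AddCommGroup U] [Module F U]
  [AddCommGroup D] [Module F D]

/-- The biadditive map `((a, q), (c, d, s)) ↦ (T a c + ε q c + ε s a, ε q d, q s)`. -/
def augmentedBimap (ε : R →+* F) (T : U →+ U →+ U) : U × R →+ U × D × R →+ U × D × R :=
  AddMonoidHom.mk' (fun a => AddMonoidHom.mk'
    (fun c => (T a.1 c.1 + ε a.2 • c.1 + ε c.2.2 • a.1, ε a.2 • c.2.1, a.2 * c.2.2))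
    (fun c c' => by
      refine Prod.ext ?_ (Prod.ext ?_ ?_)
      · simp only [Prod.fst_add, Prod.snd_add, map_add, smul_add, add_smul]
        abel
      · exact smul_add _ _ _
      · exact mul_add _ _ _))
    (fun a a' => AddMonoidHom.ext fun c => by
      refine Prod.ext ?_ (Prod.ext ?_ ?_)
      · simp only [AddMonoidHom.mk'_apply, AddMonoidHom.add_apply, Prod.fst_add, Prod.snd_add,
          map_add, smul_add, add_smul]
        abel
      · simp [add_smul]
      · simp [add_mul])

theorem augmentedBimap_apply (ε : R →+* F) (T : U →+ U →+ U) (a : U × R) (c : U × D × R) :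
    augmentedBimap ε T a c =
      (T a.1 c.1 + ε a.2 • c.1 + ε c.2.2 • a.1, ε a.2 • c.2.1, a.2 * c.2.2) := rfl

theorem augmentedBimap_one_bijective (ε : R →+* F) (T : U →+ U →+ U) :
    Function.Bijective (augmentedBimap (D := D) ε T (0, 1)) := by
  have h : ⇑(augmentedBimap (D := D) ε T (0, 1)) = id := by
    ext c : 1
    simp [augmentedBimap_apply]
  rw [h]
  exact Function.bijective_id

/-- The series length of the lex-least adjoint refinement is at least `m` if `R` contains an
element `x` in the kernel of the augmentation with `x ^ m ≠ 0 = x ^ (m + 1)`. -/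
theorem le_seriesLength_augmentedBimap {p : ℕ} [Finite U] [Finite D] [Finite R]
    (hU : ∀ a : U, p • a = 0) (hD : ∀ d : D, p • d = 0) (hR : ∀ q : R, p • q = 0)
    (ε : R →+* F) (T : U →+ U →+ U) {x : R} (hx : ε x = 0) {m : ℕ} (hm : x ^ m ≠ 0)
    (hm' : x ^ (m + 1) = 0) :
    (m : ℕ∞) ≤ seriesLength (adjointRefinement
      (etaFilter p (HeisenbergGroup (augmentedBimap (D := D) ε T))) 1) := by
  let zA : AddMonoid.End (U × R) := AddMonoidHom.prodMap 0 (AddMonoidHom.mulLeft x)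
  let zC : AddMonoid.End (U × D × R) :=
    AddMonoidHom.prodMap 0 (AddMonoidHom.prodMap 0 (AddMonoidHom.mulLeft x))
  have hzA : ∀ a, zA a = (0, x * a.2) := fun _ => rfl
  have hzC : ∀ c, zC c = (0, 0, x * c.2.2) := fun _ => rfl
  have hpA : ∀ k a, (zA ^ k) (0, a) = (0, x ^ k * a) := by
    intro k
    induction k with
    | zero => intro a; simp
    | succ k ih =>
      intro a
      rw [pow_succ]
      change (zA ^ k) (zA (0, a)) = _
      rw [hzA, ih, pow_succ, mul_assoc]
  have hpC : ∀ k a, (zC ^ k) (0, 0, a) = (0, 0, x ^ k * a) := by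
    intro k
    induction k with
    | zero => intro a; simp
    | succ k ih =>
      intro a
      rw [pow_succ]
      change (zC ^ k) (zC (0, 0, a)) = _
      rw [hzC, ih, pow_succ, mul_assoc]
  refine HeisenbergGroup.le_seriesLength_adjointRefinement (e := (0, 1)) (g := (0, 0, 1))
    (fun a => Prod.ext (hU _) (hR _)) (fun c => Prod.ext (hU _) (Prod.ext (hD _) (hR _)))
    (fun c => Prod.ext (hU _) (Prod.ext (hD _) (hR _))) (augmentedBimap_one_bijective ε T) ?_
    zA zC zC ?_ ?_ ?_ ⟨m + 2, ?_⟩ ⟨m + 2, ?_⟩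
  · intro a ha
    simpa [augmentedBimap_apply, Prod.ext_iff] using ha
  · intro a c
    simp [augmentedBimap_apply, hzA, hzC, hx, mul_assoc]
  · intro a c
    simp [augmentedBimap_apply, hzC, hx, mul_left_comm]
  · intro h
    have h1 := hpA m 1
    rw [h, mul_one] at h1
    exact hm (congrArg Prod.snd h1).symm
  -- The formula `hpA` needs a vanishing U-coordinate; one preliminary application of `zA` provides
  -- it, whence m + 2 instead of m + 1.
  · refine AddMonoidHom.ext fun a => ?_
    rw [pow_succ]
    change (zA ^ (m + 1)) (zA a) = 0
    rw [hzA, hpA, hm', zero_mul]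
    rfl
  · refine AddMonoidHom.ext fun a => ?_
    rw [pow_succ]
    change (zC ^ (m + 1)) (zC a) = 0
    rw [hzC, hpC, hm', zero_mul]
    rfl

end Bimap

/-! ### How many structure constants give the same group -/

section Counting

open scoped commutatorElement

variable {p r : ℕ} {R D : Type*} [CommRing R] [AddCommGroup D] [Module (ZMod p) D]

/-- The Heisenberg group of the augmentation of the biadditive map with structure constants `t`. -/
abbrev ConstantsGroup (D : Type*) [AddCommGroup D] [Module (ZMod p) D] (ε : R →+* ZMod p)
    (t : Fin r → Fin r → Fin r → ZMod p) : Type _ :=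
  HeisenbergGroup (augmentedBimap (D := D) ε (biadditiveOfConstants t))

/-- Every scalar in `ZMod p` is the class of a natural number, so additivity does the work of
linearity. -/
theorem AddMonoidHom.eq_of_eq_single [NeZero p] {H : Type*} [AddGroup H]
    {f g : (Fin r → ZMod p) →+ H} (h : ∀ i, f (Pi.single i 1) = g (Pi.single i 1)) : f = g := by
  ext v
  rw [← Finset.univ_sum_single v]
  refine (f.eqLocus g).sum_mem fun i _ => ?_
  have hv : (Pi.single i (v i) : Fin r → ZMod p) = (v i).val • Pi.single i 1 := by
    rw [← Pi.single_smul, nsmul_eq_mul, mul_one, ZMod.natCast_zmod_val]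
  rw [hv]
  exact (f.eqLocus g).nsmul_mem (h i) _

/-- Record the images of the unit vectors of the three copies of U. The central ones fix the
isomorphism on the U-part of W; the commutators of the other two families are the images of the
vectors T(e_i, e_j), so the constants can be read off. -/
theorem card_constants_isomorphic_le [NeZero p] (ε : R →+* ZMod p) (H : Type*) [Group H]
    [Finite H] : Nat.card {t : Fin r → Fin r → Fin r → ZMod p //
      Nonempty (ConstantsGroup D ε t ≃* H)} ≤ Nat.card H ^ (3 * r) := by
  let f : ∀ t : {t : Fin r → Fin r → Fin r → ZMod p // Nonempty (ConstantsGroup D ε t ≃* H)},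
    ConstantsGroup D ε t.1 ≃* H := fun t => t.2.some
  let Φ : {t : Fin r → Fin r → Fin r → ZMod p // Nonempty (ConstantsGroup D ε t ≃* H)} →
      (Fin r → H × H × H) := fun t i =>
    (f t ⟨(Pi.single i 1, 0), 0, 0⟩, f t ⟨0, (Pi.single i 1, 0, 0), 0⟩,
      f t ⟨0, 0, (Pi.single i 1, 0, 0)⟩)
  have hΦ : Function.Injective Φ := by
    intro t t' h
    have h1 : ∀ i, f t ⟨(Pi.single i 1, 0), 0, 0⟩ = f t' ⟨(Pi.single i 1, 0), 0, 0⟩ :=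
      fun i => congrArg Prod.fst (congrFun h i)
    have h2 : ∀ i, f t ⟨0, (Pi.single i 1, 0, 0), 0⟩ = f t' ⟨0, (Pi.single i 1, 0, 0), 0⟩ :=
      fun i => congrArg (fun x => x.2.1) (congrFun h i)
    have h3 : ∀ i, f t ⟨0, 0, (Pi.single i 1, 0, 0)⟩ = f t' ⟨0, 0, (Pi.single i 1, 0, 0)⟩ :=
      fun i => congrArg (fun x => x.2.2) (congrFun h i)
    let g : ∀ t : {t : Fin r → Fin r → Fin r → ZMod p // Nonempty (ConstantsGroup D ε t ≃* H)},
        (Fin r → ZMod p) →+ Additive H := fun t =>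
      ((f t).toMonoidHom.toAdditive.comp (HeisenbergGroup.centralHom _)).comp
        (AddMonoidHom.inl _ _)
    have hg : g t = g t' := AddMonoidHom.eq_of_eq_single h3
    have key : ∀ (t : {t : Fin r → Fin r → Fin r → ZMod p //
        Nonempty (ConstantsGroup D ε t ≃* H)}) (i j : Fin r),
        ⁅f t ⟨(Pi.single i 1, 0), 0, 0⟩, f t ⟨0, (Pi.single j 1, 0, 0), 0⟩⁆ =
          f t ⟨0, 0, (t.1 i j, 0, 0)⟩ := by
      intro t i j
      rw [← map_commutatorElement, HeisenbergGroup.commutator_eq]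
      simp [augmentedBimap_apply, biadditiveOfConstants_single]
    refine Subtype.ext (funext fun i => funext fun j => ?_)
    have h4 := key t i j
    rw [h1, h2, key t' i j] at h4
    have h5 : f t ⟨0, 0, (t'.1 i j, 0, 0)⟩ = f t' ⟨0, 0, (t'.1 i j, 0, 0)⟩ :=
      DFunLike.congr_fun hg (t'.1 i j)
    have h6 := (f t).injective (h5.trans h4)
    simpa using h6.symm
  refine (Nat.card_le_card_of_injective Φ hΦ).trans (le_of_eq ?_)
  rw [Nat.card_fun, Nat.card_prod, Nat.card_prod, Nat.card_fin, pow_mul]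
  ring_nf

end Counting

/-! ### The truncated polynomial ring and the final estimate -/

/-- A finite commutative ring of characteristic `p` and order `p ^ (m + 1)`, with an augmentation to
`ZMod p` and an element `x` of augmentation zero such that `x ^ m ≠ 0 = x ^ (m + 1)`. -/
theorem exists_truncated_polynomial_ring (p : ℕ) [Fact p.Prime] (m : ℕ) :
    ∃ (R : Type) (_ : CommRing R) (_ : Finite R) (ε : R →+* ZMod p) (x : R),
      Nat.card R = p ^ (m + 1) ∧ (∀ q : R, p • q = 0) ∧ ε x = 0 ∧ x ^ m ≠ 0 ∧
        x ^ (m + 1) = 0 := by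
  let P : Polynomial (ZMod p) := Polynomial.X ^ (m + 1)
  have hP : P.Monic := Polynomial.monic_X_pow _
  have hfin : Module.Finite (ZMod p) (AdjoinRoot P) := hP.finite_adjoinRoot
  refine ⟨AdjoinRoot P, inferInstance, Module.finite_of_finite (ZMod p),
    AdjoinRoot.lift (RingHom.id _) 0 (by simp [P]), AdjoinRoot.root P, ?_, ?_, ?_, ?_, ?_⟩
  · rw [Module.natCard_eq_pow_finrank (K := ZMod p), Nat.card_zmod,
      (AdjoinRoot.powerBasis' hP).finrank, AdjoinRoot.powerBasis'_dim, Polynomial.natDegree_X_pow]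
  · intro q
    rw [← Nat.cast_smul_eq_nsmul (ZMod p), CharP.cast_eq_zero, zero_smul]
  · rw [AdjoinRoot.lift_root]
  · rw [← AdjoinRoot.mk_X, ← map_pow, Ne, AdjoinRoot.mk_eq_zero]
    intro h
    have := Polynomial.natDegree_le_of_dvd h (pow_ne_zero _ Polynomial.X_ne_zero)
    simp [P] at this
  · rw [← AdjoinRoot.mk_X, ← map_pow, AdjoinRoot.mk_self]

/-- For n ≥ 1000 the loss of 25 still leaves r ≥ 3n/10, and 27/1000 exceeds 2/729 by enough to
absorb the two terms of size n^2. -/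
theorem exponent_bound {n r : ℕ} (hn : 1000 ≤ n) (hr : n ≤ 3 * r + 25) (hr' : 3 * r ≤ n) :
    2 * (n : ℝ) ^ 3 / 729 + 1 * (n : ℝ) ^ 2 + (n * (3 * r) : ℕ) ≤ (r ^ 3 : ℕ) := by
  have h1 : (1000 : ℝ) ≤ n := by exact_mod_cast hn
  have h2 : (n : ℝ) ≤ 3 * r + 25 := by exact_mod_cast hr
  have h3 : (3 : ℝ) * r ≤ n := by exact_mod_cast hr'
  have h4 : (3 / 10 : ℝ) * n ≤ r := by linarith
  have h5 : ((3 / 10 : ℝ) * n) ^ 3 ≤ (r : ℝ) ^ 3 := pow_le_pow_left₀ (by positivity) h4 3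
  have h6 : (n : ℝ) * (3 * r) ≤ n * n := mul_le_mul_of_nonneg_left h3 (by positivity)
  have h7 : 1000 * (n : ℝ) ^ 2 ≤ n ^ 3 := by
    rw [pow_succ, mul_comm]
    exact mul_le_mul_of_nonneg_left h1 (by positivity)
  push_cast
  rw [mul_pow] at h5
  linarith [sq (n : ℝ), sq_nonneg (n : ℝ)]

theorem mainTheorem1 :
    ∃ c : ℝ, 0 < c ∧ ∀ p : ℕ, p.Prime → ∃ N : ℕ, ∀ n : ℕ, N ≤ n →
      ∃ (k : ℕ) (G : Fin k → Type) (_ : ∀ i, Group (G i)),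
        (p : ℝ) ^ (2 * (n : ℝ) ^ 3 / 729 + c * (n : ℝ) ^ 2) ≤ (k : ℝ) ∧
        (∀ i, Nat.card (G i) = p ^ n ∧
          seriesLength (etaFilter p (G i)) = 2 ∧
          ∃ α : ℕ × ℕ → Subgroup (G i),
            IsLexLeastAdjointRefinement (etaFilter p (G i)) α ∧ 6 ≤ seriesLength α) ∧
        ∀ i j, i ≠ j → IsEmpty (G i ≃* G j) := by
  refine ⟨1, one_pos, fun p hp => ⟨1000, fun n hn => ?_⟩⟩
  have : Fact p.Prime := ⟨hp⟩
  obtain ⟨R, _, _, ε, x, hcard, hR, hx, hx6, hx7⟩ := exists_truncated_polynomial_ring p 6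
  -- U occurs three times, D twice, and R, of order p^7, three times. The choice of t solves 2t ≡ n
  -- - 21 modulo 3, so every large n is reached.
  obtain ⟨r, t, ht, hnr⟩ : ∃ r t : ℕ, t ≤ 2 ∧ n = 3 * r + 2 * t + 21 :=
    ⟨(n - 21 - 2 * ((2 * (n - 21)) % 3)) / 3, (2 * (n - 21)) % 3, by omega, by omega⟩
  let D := Fin t → ZMod p
  have hF : ∀ (m : ℕ) (a : Fin m → ZMod p), p • a = 0 := fun m a => by
    rw [← Nat.cast_smul_eq_nsmul (ZMod p), CharP.cast_eq_zero, zero_smul]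
  have hcardG : ∀ τ : Fin r → Fin r → Fin r → ZMod p,
      Nat.card (ConstantsGroup D ε τ) = p ^ n := fun τ => by
    rw [HeisenbergGroup.natCard]
    simp only [Nat.card_prod, Nat.card_fun, Nat.card_fin, Nat.card_zmod, hcard, D, hnr]
    ring
  obtain ⟨k, f, hk, hf⟩ := exists_pairwise_nonisomorphic
    (fun τ : Fin r → Fin r → Fin r → ZMod p => ConstantsGroup D ε τ) ((p ^ n) ^ (3 * r))
    (fun τ => (card_constants_isomorphic_le ε _).trans_eq (by rw [hcardG]))
  have hnt : Nontrivial R := ⟨⟨x ^ 6, 0, hx6⟩⟩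
  refine ⟨k, fun i => ConstantsGroup D ε (f i), fun i => inferInstance, ?_, fun i => ?_, hf⟩
  · have hcardι : Nat.card (Fin r → Fin r → Fin r → ZMod p) = p ^ r ^ 3 := by
      simp only [Nat.card_fun, Nat.card_fin, Nat.card_zmod]
      rw [← pow_mul, ← pow_mul]
      ring_nf
    rw [hcardι, ← pow_mul] at hk
    have hp0 : (0 : ℝ) < p := by exact_mod_cast hp.pos
    have hp1 : (1 : ℝ) ≤ p := by exact_mod_cast hp.one_le
    refine le_of_mul_le_mul_left ?_ (pow_pos hp0 (n * (3 * r)))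
    calc (p : ℝ) ^ (n * (3 * r)) * (p : ℝ) ^ (2 * (n : ℝ) ^ 3 / 729 + 1 * (n : ℝ) ^ 2)
        = (p : ℝ) ^ (2 * (n : ℝ) ^ 3 / 729 + 1 * (n : ℝ) ^ 2 + (n * (3 * r) : ℕ)) := by
          rw [Real.rpow_add hp0 _ ((n * (3 * r) : ℕ) : ℝ), Real.rpow_natCast, mul_comm]
      _ ≤ (p : ℝ) ^ ((r ^ 3 : ℕ) : ℝ) := Real.rpow_le_rpow_of_exponent_le hp1
          (exponent_bound hn (by omega) (by omega))
      _ ≤ (p : ℝ) ^ (n * (3 * r)) * k := by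
          rw [Real.rpow_natCast]
          exact_mod_cast hk
  · have hA : ∀ a : (Fin r → ZMod p) × R, p • a = 0 := fun a => Prod.ext (hF r _) (hR _)
    have hC : ∀ c : (Fin r → ZMod p) × D × R, p • c = 0 := fun c =>
      Prod.ext (hF r _) (Prod.ext (hF t _) (hR _))
    have he := augmentedBimap_one_bijective (D := D) ε (biadditiveOfConstants (f i))
    exact ⟨hcardG _, HeisenbergGroup.seriesLength_etaFilter hA hC hC he.surjective, _,
      HeisenbergGroup.isLexLeastAdjointRefinement hA hC he.surjective,
      le_seriesLength_augmentedBimap (hF r) (hF t) hR ε _ hx hx6 hx7⟩
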